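/- Let $L$ be a completely regular frame, let $\mathcal{R}L$ be the commutative ring of real-valued continuous functions on $L$ (frame homomorphisms from the frame of reals $\mathcal{L}(\mathbb{R})$ to $L$), and for $\varphi\in\mathcal{R}L$ let $$\operatorname{coz}\varphi=\bigvee\{\varphi(p,0)\vee\varphi(0,q)\mid p,q\in\mathbb{Q}\},\qquad \operatorname{Coz}L=\{\operatorname{coz}\varphi\mid\varphi\in\mathcal{R}L\}.$$ The frame $L$ is a $P_F$-frame if, whenever $a,b\in\operatorname{Coz}L$ and $a\wedge b=0$, at least one of $a,b$ is complemented in $L$. An ideal $I$ of $\mathcal{R}L$ is a $z$-ideal if $\varphi\in I$ and $\operatorname{coz}\alpha=\operatorname{coz}\varphi$ imply $\alpha\in I$; it is an $r$-ideal if $\alpha\varphi\in I$ with $\varphi$ a regular element (non-zero-divisor) of $\mathcal{R}L$ implies $\alpha\in I$; it is a $z_r$-ideal if it is both a $z$-ideal and an $r$-ideal. The following statements are equivalent. 1. The sum of every two $z_r$-ideals of $\mathcal{R}L$ is a $z_r$-ideal or all of $\mathcal{R}L$, and of any two ideals of $\mathcal{R}L$ whose sum is a proper $z_r$-ideal, at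 least one is a $z_r$-ideal. 2. $L$ is a $P_F$-frame. 3. Of any two ideals of $\mathcal{R}L$ whose intersection is a $z_r$-ideal, at least one is a $z_r$-ideal. -/

import Mathlib

open TopologicalSpace

noncomputable section

namespace PFFrame

universe u v w

/-! ### Frame homomorphisms out of frames of open sets -/

section Pairing

variable {L : Type u} [Order.Frame L]

/-- The open rectangle `V × W`. -/
def box {X : Type v} {Y : Type w} [TopologicalSpace X] [TopologicalSpace Y]
    (V : Opens X) (W : Opens Y) : Opens (X × Y) :=
  ⟨(V : Set X) ×ˢ (W : Set Y), V.isOpen.prod W.isOpen⟩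

theorem box_mono {X : Type v} {Y : Type w} [TopologicalSpace X] [TopologicalSpace Y]
    {V V' : Opens X} {W W' : Opens Y} (hV : V ≤ V') (hW : W ≤ W') : box V W ≤ box V' W' :=
  Set.prod_mono hV hW

theorem eq_sSup_box {X : Type v} {Y : Type w} [TopologicalSpace X] [TopologicalSpace Y]
    (U : Opens (X × Y)) :
    U = sSup {B | B ≤ U ∧ ∃ V W, B = box V W} := by
  apply le_antisymm
  · rintro ⟨x, y⟩ hxy
    obtain ⟨A, B, hA, hB, hx, hy, hAB⟩ := isOpen_prod_iff.1 U.isOpen x y hxy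
    exact Opens.mem_sSup.2 ⟨box ⟨A, hA⟩ ⟨B, hB⟩, ⟨hAB, _, _, rfl⟩, ⟨hx, hy⟩⟩
  · exact sSup_le fun B hB => hB.1

/-- Two frame homomorphisms on the open sets of a product agree if they agree on rectangles. -/
theorem hom_ext_box {X : Type v} {Y : Type w} [TopologicalSpace X] [TopologicalSpace Y]
    {f g : FrameHom (Opens (X × Y)) L} (h : ∀ V W, f (box V W) = g (box V W)) : f = g := by
  ext U
  rw [eq_sSup_box U, map_sSup, map_sSup]
  congr 1
  apply Set.image_congr
  rintro B ⟨-, V, W, rfl⟩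
  exact h V W

/-- The underlying map of the pairing of `α` and `β`:
`U ↦ ⋁ {α V ∧ β W | V × W ⊆ U}`. -/
def pairFun {X : Type v} {Y : Type w} [TopologicalSpace X] [TopologicalSpace Y]
    (α : FrameHom (Opens X) L) (β : FrameHom (Opens Y) L) (U : Opens (X × Y)) : L :=
  ⨆ (V : Opens X) (W : Opens Y) (_ : box V W ≤ U), α V ⊓ β W

theorem le_pairFun {X : Type v} {Y : Type w} [TopologicalSpace X] [TopologicalSpace Y]
    (α : FrameHom (Opens X) L) (β : FrameHom (Opens Y) L) {U : Opens (X × Y)}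
    {V : Opens X} {W : Opens Y} (h : box V W ≤ U) : α V ⊓ β W ≤ pairFun α β U :=
  le_iSup_of_le V (le_iSup_of_le W (le_iSup_of_le h le_rfl))

theorem pairFun_mono {X : Type v} {Y : Type w} [TopologicalSpace X] [TopologicalSpace Y]
    (α : FrameHom (Opens X) L) (β : FrameHom (Opens Y) L) : Monotone (pairFun α β) :=
  fun _ _ h => iSup_le fun _ => iSup_le fun _ => iSup_le fun h' => le_pairFun α β (h'.trans h)

theorem pairFun_inf {X : Type v} {Y : Type w} [TopologicalSpace X] [TopologicalSpace Y]
    (α : FrameHom (Opens X) L) (β : FrameHom (Opens Y) L) (U U' : Opens (X × Y)) :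
    pairFun α β (U ⊓ U') = pairFun α β U ⊓ pairFun α β U' := by
  apply le_antisymm
  · exact le_inf (pairFun_mono α β inf_le_left) (pairFun_mono α β inf_le_right)
  · conv_lhs => unfold pairFun
    simp only [iSup_inf_eq, inf_iSup_eq]
    refine iSup_le fun V => iSup_le fun W => iSup_le fun h => iSup_le fun V' => iSup_le fun W' =>
      iSup_le fun h' => ?_
    rw [inf_inf_inf_comm, ← map_inf, ← map_inf]
    exact le_pairFun α β (le_inf ((box_mono inf_le_left inf_le_left).trans h')
      ((box_mono inf_le_right inf_le_right).trans h))

theorem pairFun_sSup {X : Type v} {Y : Type w} [TopologicalSpace X] [TopologicalSpace Y]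
    [LocallyCompactSpace Y]
    (α : FrameHom (Opens X) L) (β : FrameHom (Opens Y) L) (S : Set (Opens (X × Y))) :
    pairFun α β (sSup S) = sSup (pairFun α β '' S) := by
  apply le_antisymm
  swap
  · refine sSup_le ?_
    rintro _ ⟨U, hU, rfl⟩
    exact pairFun_mono α β (le_sSup hU)
  refine iSup_le fun V => iSup_le fun W => iSup_le fun h => ?_
  set T := sSup (pairFun α β '' S) with hT
  -- `W` is the union of the open sets contained in a compact subset of `W`
  have hW : W = sSup {K : Opens Y | ∃ C : Set Y, IsCompact C ∧ (K : Set Y) ⊆ C ∧ C ⊆ W} := by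
    apply le_antisymm
    · intro y hy
      obtain ⟨C, hC, hyC, hCW⟩ := exists_compact_subset W.isOpen hy
      exact Opens.mem_sSup.2 ⟨⟨interior C, isOpen_interior⟩, ⟨C, hC, interior_subset, hCW⟩, hyC⟩
    · refine sSup_le ?_
      rintro K ⟨C, -, h1, h2⟩
      exact h1.trans h2
  rw [hW, map_sSup, inf_sSup_eq]
  refine iSup₂_le ?_
  rintro _ ⟨K, ⟨C, hC, hKC, hCW⟩, rfl⟩
  have key : ∀ x ∈ V, ∃ A : Opens X, x ∈ A ∧ α A ⊓ β K ≤ T := by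
    intro x hx
    have loc : ∀ y ∈ C, ∃ A : Opens X, ∃ B : Opens Y, x ∈ A ∧ y ∈ B ∧ α A ⊓ β B ≤ T := by
      intro y hy
      have hxy : (x, y) ∈ sSup S := h ⟨hx, hCW hy⟩
      obtain ⟨U, hU, hxyU⟩ := Opens.mem_sSup.1 hxy
      obtain ⟨A, B, hA, hB, hxA, hyB, hAB⟩ := isOpen_prod_iff.1 U.isOpen x y hxyU
      exact ⟨⟨A, hA⟩, ⟨B, hB⟩, hxA, hyB,
        (le_pairFun α β (V := ⟨A, hA⟩) (W := ⟨B, hB⟩) hAB).trans (le_sSup ⟨U, hU, rfl⟩)⟩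
    have : ∃ A : Opens X, ∃ B : Opens Y, x ∈ A ∧ C ⊆ B ∧ α A ⊓ β B ≤ T := by
      refine hC.induction_on (p := fun D => ∃ A : Opens X, ∃ B : Opens Y,
        x ∈ A ∧ D ⊆ B ∧ α A ⊓ β B ≤ T) ?_ ?_ ?_ ?_
      · exact ⟨⊤, ⊥, trivial, Set.empty_subset _, by simp⟩
      · rintro s t hst ⟨A, B, hA, hB, hAB⟩
        exact ⟨A, B, hA, hst.trans hB, hAB⟩
      · rintro s t ⟨A, B, hA, hB, hAB⟩ ⟨A', B', hA', hB', hAB'⟩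
        refine ⟨A ⊓ A', B ⊔ B', ⟨hA, hA'⟩, ?_, ?_⟩
        · rw [Opens.coe_sup]
          exact Set.union_subset_union hB hB'
        · rw [map_sup, map_inf, inf_sup_left]
          exact sup_le ((inf_le_inf_right _ inf_le_left).trans hAB)
            ((inf_le_inf_right _ inf_le_right).trans hAB')
      · intro y hy
        obtain ⟨A, B, hA, hB, hAB⟩ := loc y hy
        exact ⟨B, mem_nhdsWithin_of_mem_nhds (B.isOpen.mem_nhds hB), A, B, hA, subset_rfl, hAB⟩
    obtain ⟨A, B, hA, hB, hAB⟩ := this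
    exact ⟨A, hA, (inf_le_inf_left _ (OrderHomClass.mono β (hKC.trans hB))).trans hAB⟩
  have hV : V ≤ sSup {A : Opens X | α A ⊓ β K ≤ T} := by
    intro x hx
    obtain ⟨A, hxA, hA⟩ := key x hx
    exact Opens.mem_sSup.2 ⟨A, hA, hxA⟩
  refine (inf_le_inf_right _ (OrderHomClass.mono α hV)).trans ?_
  rw [map_sSup, sSup_inf_eq]
  refine iSup₂_le ?_
  rintro _ ⟨A, hA, rfl⟩
  exact hA

/-- The pairing of two frame homomorphisms: for locally compact `Y` the frame of open sets of
`X × Y` is the coproduct of the frames of open sets of `X` and of `Y`. -/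
def pair {X : Type v} {Y : Type w} [TopologicalSpace X] [TopologicalSpace Y]
    [LocallyCompactSpace Y] (α : FrameHom (Opens X) L) (β : FrameHom (Opens Y) L) :
    FrameHom (Opens (X × Y)) L where
  toFun := pairFun α β
  map_inf' := pairFun_inf α β
  map_top' := by
    rw [eq_top_iff]
    refine le_trans ?_ (le_pairFun α β (V := ⊤) (W := ⊤) le_top)
    simp
  map_sSup' := pairFun_sSup α β

theorem pair_box {X : Type v} {Y : Type w} [TopologicalSpace X] [TopologicalSpace Y]
    [LocallyCompactSpace Y] (α : FrameHom (Opens X) L) (β : FrameHom (Opens Y) L)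
    (V : Opens X) (W : Opens Y) : pair α β (box V W) = α V ⊓ β W := by
  apply le_antisymm
  · refine iSup_le fun V' => iSup_le fun W' => iSup_le fun h => ?_
    by_cases hV : (V' : Set X) = ∅
    · have : V' = ⊥ := Opens.ext hV
      subst this
      simp
    by_cases hW : (W' : Set Y) = ∅
    · have : W' = ⊥ := Opens.ext hW
      subst this
      simp
    obtain ⟨x, hx⟩ := Set.nonempty_iff_ne_empty.2 hV
    obtain ⟨y, hy⟩ := Set.nonempty_iff_ne_empty.2 hW
    refine inf_le_inf (OrderHomClass.mono α ?_) (OrderHomClass.mono β ?_)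
    · intro x' hx'
      exact (h (show (x', y) ∈ box V' W' from ⟨hx', hy⟩)).1
    · intro y' hy'
      exact (h (show (x, y') ∈ box V' W' from ⟨hx, hy'⟩)).2
  · exact le_pairFun α β le_rfl

/-- Composition of a frame homomorphism with the inverse image map of a continuous function. -/
def pull {X : Type v} {Y : Type w} [TopologicalSpace X] [TopologicalSpace Y]
    (δ : FrameHom (Opens X) L) (f : C(X, Y)) : FrameHom (Opens Y) L :=
  δ.comp (Opens.comap f)

theorem pull_apply {X : Type v} {Y : Type w} [TopologicalSpace X] [TopologicalSpace Y]
    (δ : FrameHom (Opens X) L) (f : C(X, Y)) (U : Opens Y) :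
    pull δ f U = δ (Opens.comap f U) := rfl

theorem pull_pull {X Y Z : Type*} [TopologicalSpace X] [TopologicalSpace Y] [TopologicalSpace Z]
    (δ : FrameHom (Opens X) L) (f : C(X, Y)) (g : C(Y, Z)) :
    pull (pull δ f) g = pull δ (g.comp f) := rfl

theorem pair_pull {X Y Z : Type*} [TopologicalSpace X] [TopologicalSpace Y] [TopologicalSpace Z]
    [LocallyCompactSpace Y] (δ : FrameHom (Opens Z) L) (f : C(Z, X)) (g : C(Z, Y)) :
    pair (pull δ f) (pull δ g) = pull δ (f.prodMk g) := by
  apply hom_ext_box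
  intro V W
  rw [pair_box, pull_apply, pull_apply, pull_apply, ← map_inf]
  rfl

theorem pull_pair_fst {X Y : Type*} [TopologicalSpace X] [TopologicalSpace Y]
    [LocallyCompactSpace Y] (α : FrameHom (Opens X) L) (β : FrameHom (Opens Y) L) :
    pull (pair α β) ContinuousMap.fst = α := by
  ext V
  have : Opens.comap (ContinuousMap.fst : C(X × Y, X)) V = box V ⊤ := by
    ext x; simp [box]
  rw [pull_apply, this, pair_box, map_top, inf_top_eq]

theorem pull_pair_snd {X Y : Type*} [TopologicalSpace X] [TopologicalSpace Y]
    [LocallyCompactSpace Y] (α : FrameHom (Opens X) L) (β : FrameHom (Opens Y) L) :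
    pull (pair α β) ContinuousMap.snd = β := by
  ext V
  have : Opens.comap (ContinuousMap.snd : C(X × Y, Y)) V = box ⊤ V := by
    ext x; simp [box]
  rw [pull_apply, this, pair_box, map_top, top_inf_eq]

end Pairing

/-! ### The ring of real-valued continuous functions on a frame -/

/-- The set `ℛL` of real-valued continuous functions on `L`, that is, of frame homomorphisms
from the frame of reals to `L`. The frame of reals is realised as the frame of open subsets of
`ℝ`, with the interval `(p, q)` as the generator `(p, q)`; see `frameOfReals_universal`. -/
def RL (L : Type u) [Order.Frame L] : Type u := FrameHom (Opens ℝ) L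

/-- The open interval `(p, q)` with rational endpoints, as a generator of the frame of reals. -/
def ratIoo (p q : ℚ) : Opens ℝ := ⟨Set.Ioo (p : ℝ) (q : ℝ), isOpen_Ioo⟩

/-- The frame of open subsets of `ℝ` is the frame presented by generators `(p, q)`,
`p, q ∈ ℚ`, and the defining relations of the frame of reals:
(R1) `(p, q) ∧ (r, s) = (p ∨ r, q ∧ s)`, (R2) `(p, q) ∨ (r, s) = (p, s)` if `p ≤ r < q ≤ s`,
(R3) `(p, q) = ⋁ {(r, s) | p < r < s < q}`, (R4) `1 = ⋁ {(p, q) | p, q ∈ ℚ}`. -/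
theorem frameOfReals_universal {L : Type u} [Order.Frame L] (f : ℚ → ℚ → L)
    (R1 : ∀ p q r s, f p q ⊓ f r s = f (p ⊔ r) (q ⊓ s))
    (R2 : ∀ p q r s, p ≤ r → r < q → q ≤ s → f p q ⊔ f r s = f p s)
    (R3 : ∀ p q, f p q = ⨆ (r : ℚ) (s : ℚ) (_ : p < r ∧ r < s ∧ s < q), f r s)
    (R4 : (⊤ : L) = ⨆ (p : ℚ) (q : ℚ), f p q) :
    ∃! φ : FrameHom (Opens ℝ) L, ∀ p q, φ (ratIoo p q) = f p q := by
  have bot : ∀ p q, q ≤ p → f p q = ⊥ := by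
    intro p q h
    rw [R3, eq_bot_iff]
    refine iSup_le fun r => iSup_le fun s => iSup_le fun h' => ?_
    exact absurd (h'.1.trans (h'.2.1.trans h'.2.2)) (not_lt.2 h)
  have mono : ∀ p q r s, r ≤ p → q ≤ s → f p q ≤ f r s := by
    intro p q r s h1 h2
    have := R1 p q r s
    rw [sup_eq_left.2 h1, inf_eq_left.2 h2] at this
    exact inf_eq_left.1 this
  have basis : ∀ U : Opens ℝ, U = sSup {B | B ≤ U ∧ ∃ p q, B = ratIoo p q} := by
    intro U
    apply le_antisymm
    · intro x hx
      obtain ⟨a, b, hab, hU⟩ := mem_nhds_iff_exists_Ioo_subset.1 (U.isOpen.mem_nhds hx)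
      obtain ⟨p, hp1, hp2⟩ := exists_rat_btwn hab.1
      obtain ⟨q, hq1, hq2⟩ := exists_rat_btwn hab.2
      exact Opens.mem_sSup.2 ⟨ratIoo p q,
        ⟨(Set.Ioo_subset_Ioo hp1.le hq2.le).trans hU, p, q, rfl⟩, ⟨hp2, hq1⟩⟩
    · exact sSup_le fun B hB => hB.1
  let F : Opens ℝ → L := fun U => ⨆ (p : ℚ) (q : ℚ) (_ : ratIoo p q ≤ U), f p q
  have leF : ∀ {p q : ℚ} {U : Opens ℝ}, ratIoo p q ≤ U → f p q ≤ F U := fun {p q U} h =>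
    le_iSup_of_le p (le_iSup_of_le q (le_iSup_of_le h le_rfl))
  have Fmono : Monotone F := fun U U' h =>
    iSup_le fun p => iSup_le fun q => iSup_le fun h' => leF (h'.trans h)
  have Ftop : F ⊤ = ⊤ := by
    rw [eq_top_iff, R4]
    exact iSup_le fun p => iSup_le fun q => leF le_top
  have Finf : ∀ U U', F (U ⊓ U') = F U ⊓ F U' := by
    intro U U'
    apply le_antisymm
    · exact le_inf (Fmono inf_le_left) (Fmono inf_le_right)
    · simp only [F, iSup_inf_eq, inf_iSup_eq]
      refine iSup_le fun p => iSup_le fun q => iSup_le fun h => iSup_le fun r =>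
        iSup_le fun s => iSup_le fun h' => ?_
      rw [inf_comm, R1]
      apply leF
      rintro x ⟨hx1, hx2⟩
      change ((p ⊔ r : ℚ) : ℝ) < x at hx1
      change x < ((q ⊓ s : ℚ) : ℝ) at hx2
      rw [Rat.cast_max, max_lt_iff] at hx1
      rw [Rat.cast_min, lt_min_iff] at hx2
      exact ⟨h' ⟨hx1.2, hx2.2⟩, h ⟨hx1.1, hx2.1⟩⟩
  have FsSup : ∀ S, F (sSup S) = sSup (F '' S) := by
    intro S
    apply le_antisymm
    swap
    · refine sSup_le ?_
      rintro _ ⟨U, hU, rfl⟩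
      exact Fmono (le_sSup hU)
    refine iSup_le fun p' => iSup_le fun q' => iSup_le fun h => ?_
    rw [R3]
    refine iSup_le fun p => iSup_le fun q => iSup_le fun hpq => ?_
    set T := sSup (F '' S)
    have loc : ∀ x : ℝ, (p : ℝ) ≤ x → x ≤ q → ∃ a b : ℚ, (a : ℝ) < x ∧ x < b ∧ f a b ≤ T := by
      intro x h1 h2
      have hx : x ∈ sSup S := h ⟨lt_of_lt_of_le (Rat.cast_lt.2 hpq.1) h1,
        lt_of_le_of_lt h2 (Rat.cast_lt.2 hpq.2.2)⟩
      obtain ⟨U, hU, hxU⟩ := Opens.mem_sSup.1 hx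
      rw [basis U] at hxU
      obtain ⟨B, ⟨hB, a, b, rfl⟩, hxB⟩ := Opens.mem_sSup.1 hxU
      exact ⟨a, b, hxB.1, hxB.2, (leF hB).trans (le_sSup ⟨U, hU, rfl⟩)⟩
    let E : Set ℝ := {x | ∃ b : ℚ, x = b ∧ p ≤ b ∧ b ≤ q ∧ f p b ≤ T}
    have hpE : (p : ℝ) ∈ E := ⟨p, rfl, le_rfl, hpq.2.1.le, by rw [bot p p le_rfl]; exact bot_le⟩
    have hbd : BddAbove E := ⟨q, by rintro _ ⟨b, rfl, -, hb, -⟩; exact_mod_cast hb⟩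
    obtain ⟨a, b, ha, hb, hab⟩ := loc (sSup E) (le_csSup hbd hpE)
      (csSup_le ⟨_, hpE⟩ (by rintro _ ⟨b, rfl, -, hb, -⟩; exact_mod_cast hb))
    obtain ⟨_, ⟨s, rfl, hps, hsq, hs⟩, has⟩ := exists_lt_of_lt_csSup ⟨_, hpE⟩ ha
    have hsb : (s : ℝ) < b := lt_of_le_of_lt (le_csSup hbd ⟨s, rfl, hps, hsq, hs⟩) hb
    have has' : a < s := by exact_mod_cast has
    have hsb' : s < b := by exact_mod_cast hsb
    have hpb : f p b ≤ T := by
      rcases le_total p a with hpa | hap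
      · rw [← R2 p s a b hpa has' hsb'.le]
        exact sup_le hs hab
      · exact (mono p b a b hap le_rfl).trans hab
    rcases le_total b q with hbq | hqb
    · exact absurd (le_csSup hbd ⟨b, rfl, hps.trans hsb'.le, hbq, hpb⟩) (not_le.2 hb)
    · exact (mono p q p b le_rfl hqb).trans hpb
  refine ⟨{ toFun := F, map_inf' := Finf, map_top' := Ftop, map_sSup' := FsSup }, ?_, ?_⟩
  · intro p q
    change F (ratIoo p q) = f p q
    apply le_antisymm
    · refine iSup_le fun r => iSup_le fun s => iSup_le fun h => ?_
      rcases le_or_gt s r with hsr | hrs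
      · rw [bot r s hsr]; exact bot_le
      · have := (Set.Ioo_subset_Ioo_iff (by exact_mod_cast hrs : (r : ℝ) < s)).1 h
        exact mono r s p q (by exact_mod_cast this.1) (by exact_mod_cast this.2)
    · exact leF le_rfl
  · intro ψ hψ
    ext U
    change ψ U = F U
    conv_lhs => rw [basis U, map_sSup]
    apply le_antisymm
    · refine sSup_le ?_
      rintro _ ⟨_, ⟨hB, p, q, rfl⟩, rfl⟩
      rw [hψ]
      exact leF hB
    · refine iSup_le fun p => iSup_le fun q => iSup_le fun h => ?_
      rw [← hψ]
      exact le_sSup ⟨_, ⟨h, p, q, rfl⟩, rfl⟩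

section RingStructure

variable {L : Type u} [Order.Frame L]

instance : FunLike (RL L) (Opens ℝ) L := inferInstanceAs (FunLike (FrameHom (Opens ℝ) L) _ _)

instance : FrameHomClass (RL L) (Opens ℝ) L :=
  inferInstanceAs (FrameHomClass (FrameHom (Opens ℝ) L) _ _)

/-- The constant function with value `r`: it sends `U` to `1` if `r ∈ U` and to `0` otherwise. -/
def RL.const (r : ℝ) : RL L where
  toFun U := ⨆ (_ : r ∈ U), ⊤
  map_inf' U V := by
    by_cases h1 : r ∈ U <;> by_cases h2 : r ∈ V <;> simp [h1, h2]
  map_top' := by simp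
  map_sSup' S := by
    by_cases h : ∃ U ∈ S, r ∈ U
    · obtain ⟨U, hU, hr⟩ := h
      have h' : r ∈ sSup S := Opens.mem_sSup.2 ⟨U, hU, hr⟩
      rw [iSup_pos h']
      refine (top_le_iff.1 (le_sSup_of_le (Set.mem_image_of_mem _ hU) ?_)).symm
      simp only [iSup_pos hr, le_refl]
    · have h' : r ∉ sSup S := fun hr => h (by simpa using Opens.mem_sSup.1 hr)
      rw [iSup_neg h', eq_comm, eq_bot_iff]
      refine sSup_le ?_
      rintro _ ⟨U, hU, rfl⟩
      exact iSup_le fun hr => absurd ⟨U, hU, hr⟩ h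

instance : Zero (RL L) := ⟨RL.const 0⟩

instance : One (RL L) := ⟨RL.const 1⟩

/-- `(α + β)(U) = ⋁ {α(V) ∧ β(W) | V + W ⊆ U}`. -/
instance : Add (RL L) := ⟨fun α β => pull (pair α β) ⟨fun x => x.1 + x.2, by fun_prop⟩⟩

/-- `(α β)(U) = ⋁ {α(V) ∧ β(W) | V W ⊆ U}`. -/
instance : Mul (RL L) := ⟨fun α β => pull (pair α β) ⟨fun x => x.1 * x.2, by fun_prop⟩⟩

/-- `(-α)(U) = α(-U)`. -/
instance : Neg (RL L) := ⟨fun α => pull (X := ℝ) α ⟨fun x => -x, by fun_prop⟩⟩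

/-- The function `f` of the "continuous map" `δ` with values in `Z`. -/
def RL.of {Z : Type} [TopologicalSpace Z] (δ : FrameHom (Opens Z) L) (f : C(Z, ℝ)) : RL L :=
  pull δ f

variable {Z : Type} [TopologicalSpace Z] (δ : FrameHom (Opens Z) L)

theorem RL.of_add (f g : C(Z, ℝ)) : RL.of δ f + RL.of δ g = RL.of δ (f + g) :=
  (congrArg (fun ε => pull ε _) (pair_pull δ f g)).trans rfl

theorem RL.of_mul (f g : C(Z, ℝ)) : RL.of δ f * RL.of δ g = RL.of δ (f * g) :=
  (congrArg (fun ε => pull ε _) (pair_pull δ f g)).trans rfl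

theorem RL.of_neg (f : C(Z, ℝ)) : -RL.of δ f = RL.of δ (-f) := rfl

theorem RL.const_eq_of (r : ℝ) : (RL.const r : RL L) = RL.of δ (ContinuousMap.const Z r) := by
  refine DFunLike.ext (F := FrameHom (Opens ℝ) L) _ _ fun U => ?_
  change (⨆ (_ : r ∈ U), ⊤) = δ (Opens.comap (ContinuousMap.const Z r) U)
  by_cases h : r ∈ U
  · have : Opens.comap (ContinuousMap.const Z r) U = ⊤ := by ext; simpa using h
    rw [this, map_top, iSup_pos h]
  · have : Opens.comap (ContinuousMap.const Z r) U = ⊥ := by ext; simpa using h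
    rw [this, map_bot, iSup_neg h]

theorem RL.zero_eq_of : (0 : RL L) = RL.of δ 0 := RL.const_eq_of δ 0

theorem RL.one_eq_of : (1 : RL L) = RL.of δ 1 := RL.const_eq_of δ 1

/-- Any three elements of `ℛL` are functions of one "continuous map" with values in `ℝ³`. -/
theorem RL.exists_of (α β γ : RL L) :
    ∃ (δ : FrameHom (Opens (ℝ × (ℝ × ℝ))) L) (f g h : C(ℝ × (ℝ × ℝ), ℝ)),
      α = RL.of δ f ∧ β = RL.of δ g ∧ γ = RL.of δ h := by
  refine ⟨pair α (pair β γ), ContinuousMap.fst, ContinuousMap.fst.comp ContinuousMap.snd,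
    ContinuousMap.snd.comp ContinuousMap.snd, (pull_pair_fst _ _).symm, ?_, ?_⟩
  · exact ((congrArg (fun ε => pull ε ContinuousMap.fst) (pull_pair_snd α (pair β γ))).trans
      (pull_pair_fst β γ)).symm
  · exact ((congrArg (fun ε => pull ε ContinuousMap.snd) (pull_pair_snd α (pair β γ))).trans
      (pull_pair_snd β γ)).symm

instance : CommRing (RL L) where
  add_assoc α β γ := by
    obtain ⟨δ, f, g, h, rfl, rfl, rfl⟩ := RL.exists_of α β γ
    simp only [RL.of_add, add_assoc]
  zero_add α := by
    obtain ⟨δ, f, g, h, rfl, -, -⟩ := RL.exists_of α α α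
    rw [RL.zero_eq_of δ, RL.of_add, zero_add]
  add_zero α := by
    obtain ⟨δ, f, g, h, rfl, -, -⟩ := RL.exists_of α α α
    rw [RL.zero_eq_of δ, RL.of_add, add_zero]
  add_comm α β := by
    obtain ⟨δ, f, g, h, rfl, rfl, -⟩ := RL.exists_of α β β
    rw [RL.of_add, RL.of_add, add_comm]
  left_distrib α β γ := by
    obtain ⟨δ, f, g, h, rfl, rfl, rfl⟩ := RL.exists_of α β γ
    simp only [RL.of_add, RL.of_mul, mul_add]
  right_distrib α β γ := by
    obtain ⟨δ, f, g, h, rfl, rfl, rfl⟩ := RL.exists_of α β γ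
    simp only [RL.of_add, RL.of_mul, add_mul]
  zero_mul α := by
    obtain ⟨δ, f, g, h, rfl, -, -⟩ := RL.exists_of α α α
    rw [RL.zero_eq_of δ, RL.of_mul, zero_mul]
  mul_zero α := by
    obtain ⟨δ, f, g, h, rfl, -, -⟩ := RL.exists_of α α α
    rw [RL.zero_eq_of δ, RL.of_mul, mul_zero]
  mul_assoc α β γ := by
    obtain ⟨δ, f, g, h, rfl, rfl, rfl⟩ := RL.exists_of α β γ
    simp only [RL.of_mul, mul_assoc]
  one_mul α := by
    obtain ⟨δ, f, g, h, rfl, -, -⟩ := RL.exists_of α α α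
    rw [RL.one_eq_of δ, RL.of_mul, one_mul]
  mul_one α := by
    obtain ⟨δ, f, g, h, rfl, -, -⟩ := RL.exists_of α α α
    rw [RL.one_eq_of δ, RL.of_mul, mul_one]
  mul_comm α β := by
    obtain ⟨δ, f, g, h, rfl, rfl, -⟩ := RL.exists_of α β β
    rw [RL.of_mul, RL.of_mul, mul_comm]
  neg_add_cancel α := by
    obtain ⟨δ, f, g, h, rfl, -, -⟩ := RL.exists_of α α α
    rw [RL.of_neg, RL.of_add, RL.zero_eq_of δ, neg_add_cancel]
  nsmul := nsmulRec
  zsmul := zsmulRec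

end RingStructure

/-! ### Completely regular frames, cozero elements and `P_F`-frames -/

section Frames

variable {L : Type u} [Order.Frame L]

/-- `a ≺ b`: there is a separating element `t` with `a ∧ t = 0` and `t ∨ b = 1`. -/
def RatherBelow (a b : L) : Prop := ∃ t : L, a ⊓ t = ⊥ ∧ t ⊔ b = ⊤

/-- `a ≺≺ b`: there are `c q`, for rational `q` in `[0, 1]`, with `c 0 = a`, `c 1 = b` and
`c r ≺ c s` whenever `r < s`. -/
def CompletelyBelow (a b : L) : Prop :=
  ∃ c : Set.Icc (0 : ℚ) 1 → L, c 0 = a ∧ c 1 = b ∧ ∀ r s, r < s → RatherBelow (c r) (c s)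

variable (L) in
/-- The frame `L` is completely regular. -/
def IsCompletelyRegular : Prop := ∀ a : L, a = sSup {x | CompletelyBelow x a}

/-- The cozero map `coz φ = ⋁ {φ(p, 0) ∨ φ(0, q) | p, q ∈ ℚ}`. -/
def coz (φ : RL L) : L :=
  ⨆ (p : ℚ) (q : ℚ), φ (ratIoo p 0) ⊔ φ (ratIoo 0 q)

variable (L) in
/-- The set `Coz L` of cozero elements of `L`. -/
def CozPart : Set L := Set.range (coz : RL L → L)

variable (L) in
/-- `L` is a `P_F`-frame: of any two disjoint cozero elements at least one is complemented. -/
def IsPFFrame : Prop :=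
  ∀ a ∈ CozPart L, ∀ b ∈ CozPart L, a ⊓ b = ⊥ → IsComplemented a ∨ IsComplemented b

/-- `z`-ideals of `ℛL`. -/
def IsZIdeal (I : Ideal (RL L)) : Prop :=
  ∀ α φ : RL L, φ ∈ I → coz α = coz φ → α ∈ I

/-- `r`-ideals of `ℛL`; regular elements are the non-zero-divisors. -/
def IsRIdeal (I : Ideal (RL L)) : Prop :=
  ∀ α φ : RL L, IsRegular φ → α * φ ∈ I → α ∈ I

/-- `z_r`-ideals of `ℛL`. -/
def IsZrIdeal (I : Ideal (RL L)) : Prop := IsZIdeal I ∧ IsRIdeal I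

end Frames

end PFFrame

end

/-!
Let `M` be the largest ideal of `ℛL` all of whose elements are von Neumann regular. A cozero
element `coz φ` is complemented iff `φ` is von Neumann regular, so `L` is a `P_F`-frame iff
`α β = 0` forces `α ∈ M` or `β ∈ M`. Moreover `I` is a `z_r`-ideal iff `I + M` is one.

Let `L` be a `P_F`-frame. Where `|α| ≤ |β|` the quotient `α² / β` is continuous, hence
`(α² - β κ) (β² - α μ) = 0` for suitable `κ` and `μ`, and modulo `M` one of `α`, `β` divides the
square of the other. It follows that every proper `z`-ideal containing `M` is prime, so that these
ideals form a chain; together with the existence of cube roots this gives (1) and (3).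

Conversely, let `α β = 0` with neither factor von Neumann regular. Adding to `(α)` any part of the
annihilator of `α` never yields a `z`-ideal, since it would contain the cube root of `α`. As
`(α) ∩ (β) = 0` is a `z_r`-ideal, (3) fails. If (1) holds, a multiple `α'` of `α` that is still not
von Neumann regular is killed by a non-zero multiple `δ` of `α`, and the proper `z_r`-ideal
`Ann(α', δ) + Ann(β, δ)` is the sum of `(α') + Ann(α', δ)` and `(β) + Ann(β, δ)`, a contradiction.
-/

namespace PFFrame

section VonNeumannRegular

/-- Von Neumann regular elements: since multiplication is commutative, the usual condition
`x = x k x` says that `x ^ 2` divides `x`. -/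
def IsVonNeumannRegular {R : Type*} [CommMonoid R] (x : R) : Prop := x ^ 2 ∣ x

variable {R : Type*} [CommRing R] {x : R}

theorem IsVonNeumannRegular.of_sub_sq_mul {k : R} (h : IsVonNeumannRegular (x - x ^ 2 * k)) :
    IsVonNeumannRegular x := by
  obtain ⟨l, hl⟩ := h
  exact ⟨(1 - x * k) ^ 2 * l + k, by linear_combination hl⟩

variable (R) in
/-- The largest ideal all of whose elements are von Neumann regular (Brown and McCoy's maximal
regular ideal). -/
def vonNeumannRegularIdeal : Ideal R where
  carrier := {x | ∀ y, x ∣ y → IsVonNeumannRegular y}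
  zero_mem' y h := by simp [zero_dvd_iff.1 h, IsVonNeumannRegular]
  add_mem' := by
    rintro a b ha hb _ ⟨r, rfl⟩
    obtain ⟨k, hk⟩ := ha (a * r) (Dvd.intro r rfl)
    refine IsVonNeumannRegular.of_sub_sq_mul (k := k) (hb _ ?_)
    exact ⟨r - 2 * a * r ^ 2 * k - b * r ^ 2 * k, by linear_combination hk⟩
  smul_mem' c _ hx y h := hx y (dvd_of_mul_left_dvd h)

theorem mem_vonNeumannRegularIdeal :
    x ∈ vonNeumannRegularIdeal R ↔ ∀ y, x ∣ y → IsVonNeumannRegular y := Iff.rfl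

theorem mem_sup_vonNeumannRegularIdeal {I : Ideal R} :
    x ∈ I ⊔ vonNeumannRegularIdeal R ↔ ∃ e ∈ vonNeumannRegularIdeal R, x * (1 - e) ∈ I := by
  constructor
  · intro hx
    obtain ⟨i, hi, m, hm, rfl⟩ := Submodule.mem_sup.1 hx
    obtain ⟨k, hk⟩ := hm m dvd_rfl
    refine ⟨m * k, Ideal.mul_mem_right _ _ hm, ?_⟩
    convert I.mul_mem_right (1 - m * k) hi using 1
    linear_combination hk
  · rintro ⟨e, he, hxe⟩
    rw [show x = x * (1 - e) + x * e by ring]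
    exact Submodule.add_mem_sup hxe (Ideal.mul_mem_left _ _ he)

end VonNeumannRegular

section FrameHoms

variable {L : Type*} [Order.Frame L]

/-- The frame homomorphism `U ↦ ⋁ {c i | i ∈ U}` given by a decomposition of the top element into
pairwise disjoint elements `c i`: the "continuous map" with value `i` on `c i`. -/
def partitionHom {ι : Type*} [TopologicalSpace ι] (c : ι → L)
    (hdisj : Pairwise (Function.onFun Disjoint c)) (htop : ⨆ i, c i = ⊤) :
    FrameHom (Opens ι) L where
  toFun U := ⨆ i ∈ U, c i
  map_inf' U V := by
    apply le_antisymm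
    · exact le_inf (biSup_mono fun i hi => hi.1) (biSup_mono fun i hi => hi.2)
    · simp only [iSup_inf_eq, inf_iSup_eq]
      refine iSup₂_le fun i hi => iSup₂_le fun j hj => ?_
      rcases eq_or_ne i j with rfl | hij
      · exact inf_le_left.trans (le_iSup₂_of_le i ⟨by assumption, by assumption⟩ le_rfl)
      · simp [(hdisj hij.symm).eq_bot]
  map_top' := by simpa using htop
  map_sSup' S := by
    simp only [sSup_image, Opens.mem_sSup, iSup_exists, iSup_and]
    rw [iSup_comm]
    exact iSup_congr fun U => iSup_comm

theorem exists_pull_eq_of_isOpenEmbedding {X Z : Type*} [TopologicalSpace X] [TopologicalSpace Z]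
    {i : C(Z, X)} (hi : Topology.IsOpenEmbedding i) (δ : FrameHom (Opens X) L)
    (hδ : δ ⟨Set.range i, hi.isOpen_range⟩ = ⊤) :
    ∃ ε : FrameHom (Opens Z) L, pull ε i = δ := by
  let image (V : Opens Z) : Opens X := ⟨i '' V, hi.isOpenMap V V.isOpen⟩
  refine ⟨{ toFun := fun V => δ (image V), map_inf' := ?_, map_top' := ?_, map_sSup' := ?_ }, ?_⟩
  · intro V W
    rw [← map_inf]
    exact congrArg δ (Opens.ext (Set.image_inter hi.injective))
  · rw [← hδ]
    exact congrArg δ (Opens.ext Set.image_univ)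
  · intro S
    have image_sSup : image (sSup S) = sSup (image '' S) := by
      ext x
      simp only [image, Opens.coe_sSup, Opens.coe_mk, Set.image_iUnion, Set.mem_iUnion,
        Set.biUnion_image]
    rw [image_sSup, map_sSup, Set.image_image]
  · ext U
    have image_comap : image (Opens.comap i U) = U ⊓ ⟨Set.range i, hi.isOpen_range⟩ :=
      Opens.ext Set.image_preimage_eq_inter_range
    change δ (image (Opens.comap i U)) = δ U
    rw [image_comap, map_inf, hδ, inf_top_eq]

end FrameHoms

section Cozero

variable {L : Type*} [Order.Frame L] {α β γ φ : RL L}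

/-- The ring homomorphism `f ↦ f ∘ δ` for a "continuous map" `δ` from `L` to `Z`. It reduces
computations with finitely many elements of `ℛL` to computations with real-valued functions on a
space. -/
def RL.ofRingHom {Z : Type} [TopologicalSpace Z] (δ : FrameHom (Opens Z) L) :
    C(Z, ℝ) →+* RL L where
  toFun := RL.of δ
  map_one' := (RL.one_eq_of δ).symm
  map_mul' f g := (RL.of_mul δ f g).symm
  map_zero' := (RL.zero_eq_of δ).symm
  map_add' f g := (RL.of_add δ f g).symm

theorem RL.exists_ofRingHom (α β : RL L) :
    ∃ (δ : FrameHom (Opens (ℝ × (ℝ × ℝ))) L) (f g : C(ℝ × (ℝ × ℝ), ℝ)),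
      α = RL.ofRingHom δ f ∧ β = RL.ofRingHom δ g := by
  obtain ⟨δ, f, g, -, hα, hβ, -⟩ := RL.exists_of α β β
  exact ⟨δ, f, g, hα, hβ⟩

/-- The real line without the origin. -/
def punctured : Opens ℝ := ⟨{0}ᶜ, isOpen_compl_singleton⟩

theorem mem_punctured {x : ℝ} : x ∈ punctured ↔ x ≠ 0 := Iff.rfl

theorem punctured_eq_iSup_ratIoo : punctured = ⨆ (p : ℚ) (q : ℚ), ratIoo p 0 ⊔ ratIoo 0 q := by
  have mem_ratIoo {x : ℝ} {p q : ℚ} : x ∈ ratIoo p q ↔ (p : ℝ) < x ∧ x < q := Iff.rfl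
  ext x
  simp only [SetLike.mem_coe, mem_punctured, Opens.mem_iSup, Opens.mem_sup, mem_ratIoo,
    Rat.cast_zero]
  constructor
  · intro hx
    obtain ⟨p, hp⟩ := exists_rat_lt x
    obtain ⟨q, hq⟩ := exists_rat_gt x
    exact ⟨p, q, hx.lt_or_gt.imp (⟨hp, ·⟩) (⟨·, hq⟩)⟩
  · rintro ⟨p, q, h | h⟩
    exacts [h.2.ne, h.1.ne']

theorem coz_eq_apply_punctured (φ : RL L) : coz φ = φ punctured := by
  simp only [punctured_eq_iSup_ratIoo, coz, map_iSup, map_sup]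

theorem coz_ofRingHom {Z : Type} [TopologicalSpace Z] (δ : FrameHom (Opens Z) L) (f : C(Z, ℝ)) :
    coz (RL.ofRingHom δ f) = δ (Opens.comap f punctured) :=
  coz_eq_apply_punctured _

theorem coz_ofRingHom_mono {Z : Type} [TopologicalSpace Z] (δ : FrameHom (Opens Z) L)
    {f g : C(Z, ℝ)} (h : ∀ z, g z = 0 → f z = 0) :
    coz (RL.ofRingHom δ f) ≤ coz (RL.ofRingHom δ g) := by
  rw [coz_ofRingHom, coz_ofRingHom]
  exact OrderHomClass.mono δ fun z hz => mt (h z) hz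

theorem coz_mul (α β : RL L) : coz (α * β) = coz α ⊓ coz β := by
  obtain ⟨δ, f, g, rfl, rfl⟩ := RL.exists_ofRingHom α β
  rw [← map_mul, coz_ofRingHom, coz_ofRingHom, coz_ofRingHom, ← map_inf]
  congr 1
  ext z
  exact mul_ne_zero_iff

theorem coz_add_le (α β : RL L) : coz (α + β) ≤ coz α ⊔ coz β := by
  obtain ⟨δ, f, g, rfl, rfl⟩ := RL.exists_ofRingHom α β
  rw [← map_add, coz_ofRingHom, coz_ofRingHom, coz_ofRingHom, ← map_sup]
  refine OrderHomClass.mono δ fun z (hz : f z + g z ≠ 0) => ?_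
  by_contra! h
  obtain ⟨hf, hg⟩ : f z = 0 ∧ g z = 0 := by simpa [mem_punctured] using h
  exact hz (by rw [hf, hg, add_zero])

theorem coz_one : coz (1 : RL L) = ⊤ := by
  rw [coz_eq_apply_punctured]
  exact iSup_pos (mem_punctured.2 one_ne_zero)

theorem coz_zero : coz (0 : RL L) = ⊥ := by
  rw [coz_eq_apply_punctured]
  exact iSup_neg (not_not.2 rfl)

theorem coz_eq_bot_iff : coz φ = ⊥ ↔ φ = 0 := by
  refine ⟨fun h => ?_, fun h => h ▸ coz_zero⟩
  rw [coz_eq_apply_punctured] at h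
  refine DFunLike.ext (F := FrameHom (Opens ℝ) L) _ _ fun U => ?_
  change φ U = ⨆ _ : (0 : ℝ) ∈ U, ⊤
  by_cases hU : (0 : ℝ) ∈ U
  · have hcover : U ⊔ punctured = ⊤ := by
      ext x
      simpa [mem_punctured] using or_iff_not_imp_right.2 fun hx => not_not.1 hx ▸ hU
    rw [iSup_pos hU, ← map_top φ, ← hcover, map_sup, h, sup_bot_eq]
  · rw [iSup_neg hU, eq_bot_iff, ← h]
    exact OrderHomClass.mono φ fun x hx => mem_punctured.2 fun h0 => hU (h0 ▸ hx)

theorem coz_inf_coz_eq_bot_iff : coz α ⊓ coz β = ⊥ ↔ α * β = 0 := by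
  rw [← coz_mul, coz_eq_bot_iff]

theorem mul_eq_zero_of_coz_le (h : coz α ≤ coz β) (hβγ : β * γ = 0) : α * γ = 0 := by
  rw [← coz_inf_coz_eq_bot_iff, ← le_bot_iff] at *
  exact (inf_le_inf_right _ h).trans hβγ

theorem coz_anti_of_dvd (h : α ∣ β) : coz β ≤ coz α := by
  obtain ⟨γ, rfl⟩ := h
  exact (coz_mul α γ).trans_le inf_le_left

theorem coz_pow (α : RL L) {n : ℕ} (hn : n ≠ 0) : coz (α ^ n) = coz α := by
  induction n, Nat.one_le_iff_ne_zero.2 hn using Nat.le_induction with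
  | base => rw [pow_one]
  | succ n hn ih => rw [pow_succ, coz_mul, ih (by lia), inf_idem]

instance : IsReduced (RL L) where
  eq_zero α := by
    rintro ⟨n, hn⟩
    rcases eq_or_ne n 0 with rfl | hn0
    · rw [← mul_one α, ← pow_zero α, hn, mul_zero]
    · rw [← coz_eq_bot_iff, ← coz_pow α hn0, hn, coz_zero]

theorem exists_pow_eq_of_odd {n : ℕ} (hn : Odd n) (φ : RL L) : ∃ ρ : RL L, ρ ^ n = φ := by
  have hsurj : Function.Surjective fun t : ℝ => t ^ n := by
    have htop := Filter.tendsto_pow_atTop (α := ℝ) hn.pos.ne'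
    refine (continuous_pow n).surjective htop ?_
    exact (Filter.tendsto_neg_atTop_atBot.comp (htop.comp Filter.tendsto_neg_atBot_atTop)).congr
      fun t => by simp [hn.neg_pow]
  let power : ℝ ≃o ℝ := hn.strictMono_pow.orderIsoOfSurjective _ hsurj
  let root : C(ℝ, ℝ) := ⟨power.symm, power.symm.continuous⟩
  obtain ⟨δ, f, -, rfl, -⟩ := RL.exists_ofRingHom φ φ
  refine ⟨RL.ofRingHom δ (root.comp f), ?_⟩
  rw [← map_pow]
  congr 1
  ext z
  exact power.apply_symm_apply (f z)

end Cozero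

section ComplementedCozero

variable {L : Type*} [Order.Frame L] {φ : RL L}

theorem coz_eq_top_iff_isUnit : coz φ = ⊤ ↔ IsUnit φ := by
  constructor
  · intro h
    let i : C({t : ℝ // t ≠ 0}, ℝ) := ⟨Subtype.val, continuous_subtype_val⟩
    let inv : C({t : ℝ // t ≠ 0}, ℝ) := ⟨fun t => (t : ℝ)⁻¹, continuous_subtype_val.inv₀ (·.2)⟩
    have hi : Topology.IsOpenEmbedding i := isOpen_compl_singleton.isOpenEmbedding_subtypeVal
    have hrange : (⟨Set.range i, hi.isOpen_range⟩ : Opens ℝ) = punctured :=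
      Opens.ext Subtype.range_val
    rw [coz_eq_apply_punctured, ← hrange] at h
    obtain ⟨ε, hε⟩ := exists_pull_eq_of_isOpenEmbedding hi φ h
    have hinv : i * inv = 1 := by
      ext t
      exact mul_inv_cancel₀ t.2
    refine IsUnit.of_mul_eq_one (RL.ofRingHom ε inv) ?_
    rw [← map_one (RL.ofRingHom ε), ← hinv, map_mul]
    exact congrArg (· * RL.ofRingHom ε inv) hε.symm
  · intro h
    rw [← top_le_iff, ← coz_one]
    exact coz_anti_of_dvd h.dvd

theorem exists_isIdempotentElem_coz_eq {a : L} (ha : IsComplemented a) :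
    ∃ e : RL L, IsIdempotentElem e ∧ coz e = a := by
  obtain ⟨b, hab⟩ := ha
  let δ : FrameHom (Opens Bool) L := partitionHom (fun i => bif i then a else b)
    (pairwise_on_bool.2 hab.disjoint) (by rw [iSup_bool_eq]; exact hab.sup_eq_top)
  let χ : C(Bool, ℝ) := ⟨Bool.rec 0 1, continuous_of_discreteTopology⟩
  refine ⟨RL.ofRingHom δ χ, ?_, ?_⟩
  · have hχ : χ * χ = χ := by
      ext (_ | _)
      exacts [mul_zero _, mul_one _]
    rw [IsIdempotentElem, ← map_mul, hχ]
  · rw [coz_ofRingHom]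
    change ⨆ i, ⨆ _ : χ i ≠ 0, (bif i then a else b) = a
    simp [iSup_bool_eq, χ]

theorem isComplemented_coz_iff : IsComplemented (coz φ) ↔ IsVonNeumannRegular φ := by
  constructor
  · intro h
    obtain ⟨e, he, hcoz⟩ := exists_isIdempotentElem_coz_eq h
    have hφe : φ * (1 - e) = 0 := mul_eq_zero_of_coz_le hcoz.ge he.mul_one_sub_self
    have hunit : IsUnit (φ + (1 - e)) := by
      rw [← coz_eq_top_iff_isUnit, ← top_le_iff]
      calc ⊤ = coz (e + (1 - e)) := by rw [add_sub_cancel, coz_one]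
        _ ≤ coz φ ⊔ coz (1 - e) := hcoz ▸ coz_add_le _ _
        _ ≤ coz (φ + (1 - e)) := sup_le
            (coz_anti_of_dvd ⟨e, by linear_combination hφe + he.eq⟩)
            (coz_anti_of_dvd ⟨1 - e, by linear_combination -hφe - he.eq⟩)
    obtain ⟨u, hu⟩ := hunit.exists_right_inv
    exact ⟨u, by linear_combination u * hφe - φ * hu⟩
  · rintro ⟨k, hk⟩
    refine ⟨coz (1 - φ * k), IsCompl.of_eq ?_ ?_⟩
    · rw [coz_inf_coz_eq_bot_iff]
      linear_combination hk
    · rw [← top_le_iff]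
      calc ⊤ = coz (φ * k + (1 - φ * k)) := by rw [add_sub_cancel, coz_one]
        _ ≤ coz (φ * k) ⊔ coz (1 - φ * k) := coz_add_le _ _
        _ ≤ coz φ ⊔ coz (1 - φ * k) := sup_le_sup_right (coz_anti_of_dvd ⟨k, rfl⟩) _

end ComplementedCozero

section ZeroProducts

/-- The witness is `x ^ 2 * y / max (x ^ 2) (y ^ 2)`, extended by the junk value `0 / 0 = 0`. -/
theorem exists_continuousMap_mul_eq_sq :
    ∃ q : C(ℝ × ℝ, ℝ), ∀ x y : ℝ, |x| ≤ |y| → y * q (x, y) = x ^ 2 := by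
  let m (z : ℝ × ℝ) : ℝ := max (z.1 ^ 2) (z.2 ^ 2)
  have hm : Continuous m := by fun_prop
  have m_nonneg (z : ℝ × ℝ) : 0 ≤ m z := le_max_of_le_left (sq_nonneg _)
  let q (z : ℝ × ℝ) : ℝ := z.2 * (z.1 ^ 2 / m z)
  have abs_q_le (z : ℝ × ℝ) : |q z| ≤ |z.2| := by
    rw [abs_mul, abs_of_nonneg (div_nonneg (sq_nonneg _) (m_nonneg z))]
    exact mul_le_of_le_one_right (abs_nonneg _)
      (div_le_one_of_le₀ (le_max_left _ _) (m_nonneg z))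
  have hq : Continuous q := continuous_iff_continuousAt.2 fun z => by
    by_cases hz : m z = 0
    · have hz2 : z.2 = 0 := pow_eq_zero_iff two_ne_zero |>.1
        (le_antisymm (hz ▸ le_max_right _ _) (sq_nonneg _))
      have hqz : q z = 0 := by simp [q, hz2]
      rw [ContinuousAt, hqz]
      have hlim : Filter.Tendsto (fun w : ℝ × ℝ => |w.2|) (nhds z) (nhds |z.2|) :=
        (continuous_snd.abs).tendsto z
      rw [hz2, abs_zero] at hlim
      exact squeeze_zero_norm abs_q_le hlim
    · exact continuousAt_snd.mul ((continuousAt_fst.pow 2).div hm.continuousAt hz)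
  refine ⟨⟨q, hq⟩, fun x y hxy => ?_⟩
  change y * (y * (x ^ 2 / max (x ^ 2) (y ^ 2))) = x ^ 2
  rw [max_eq_right (sq_le_sq.2 hxy)]
  rcases eq_or_ne y 0 with rfl | hy
  · simp_all
  · field_simp

variable {L : Type*} [Order.Frame L]

theorem exists_sq_sub_mul_mul_sq_sub_mul_eq_zero (α β : RL L) :
    ∃ κ μ : RL L, (α ^ 2 - β * κ) * (β ^ 2 - α * μ) = 0 := by
  obtain ⟨δ, f, g, rfl, rfl⟩ := RL.exists_ofRingHom α β
  obtain ⟨q, hq⟩ := exists_continuousMap_mul_eq_sq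
  refine ⟨RL.ofRingHom δ (q.comp (f.prodMk g)), RL.ofRingHom δ (q.comp (g.prodMk f)), ?_⟩
  simp only [← map_pow, ← map_mul, ← map_sub]
  rw [← map_zero (RL.ofRingHom δ)]
  congr 1
  ext z
  change (f z ^ 2 - g z * q (f z, g z)) * (g z ^ 2 - f z * q (g z, f z)) = 0
  rcases le_total |f z| |g z| with h | h
  · rw [hq _ _ h, sub_self, zero_mul]
  · rw [hq _ _ h, sub_self, mul_zero]

section Truncations

variable {Z : Type} [TopologicalSpace Z] {δ : FrameHom (Opens Z) L} {f : C(Z, ℝ)}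

theorem ofRingHom_eq_zero_of_forall_mul_posPart
    (h : ∀ r : ℝ, 0 < r → RL.ofRingHom δ (f * (|f| - ContinuousMap.const Z r)⁺) = 0) :
    RL.ofRingHom δ f = 0 := by
  let V (r : ℝ) : Opens Z := Opens.comap (f * (|f| - ContinuousMap.const Z r)⁺) punctured
  have hcover : Opens.comap f punctured ≤ ⨆ r : Set.Ioi (0 : ℝ), V r := by
    intro z (hz : f z ≠ 0)
    have habs : 0 < |f z| := abs_pos.2 hz
    have hcut : max (|f z| - |f z| / 2) 0 ≠ 0 := (lt_max_of_lt_left (by linarith)).ne'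
    exact Opens.mem_iSup.2 ⟨⟨|f z| / 2, half_pos habs⟩, mul_ne_zero hz hcut⟩
  rw [← coz_eq_bot_iff, coz_ofRingHom, ← le_bot_iff]
  refine (OrderHomClass.mono δ hcover).trans ?_
  rw [map_iSup]
  exact iSup_le fun r => (coz_ofRingHom δ _ ▸ coz_eq_bot_iff.2 (h r r.2)).le

theorem isVonNeumannRegular_ofRingHom_of_mul_negPart {r : ℝ} (hr : 0 < r)
    (h : RL.ofRingHom δ (f * (|f| - ContinuousMap.const Z r)⁻) = 0) :
    IsVonNeumannRegular (RL.ofRingHom δ f) := by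
  have hmax (z : Z) : max |f z| r ≠ 0 := (hr.trans_le (le_max_right _ _)).ne'
  let k : C(Z, ℝ) := ⟨fun z => f z / max |f z| r ^ 2,
    Continuous.div (by fun_prop) (by fun_prop) fun z => pow_ne_zero 2 (hmax z)⟩
  have hzero (z : Z) (hz : (f * (|f| - ContinuousMap.const Z r)⁻) z = 0) :
      (f - f ^ 2 * k) z = 0 := by
    change f z - f z ^ 2 * (f z / max |f z| r ^ 2) = 0
    rcases mul_eq_zero.1 hz with hf | hcut
    · simp [hf]
    · have hle : r ≤ |f z| := by
        have : max (-(|f z| - r)) 0 = 0 := hcut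
        linarith [max_eq_right_iff.1 this]
      have hf : f z ≠ 0 := abs_pos.1 (hr.trans_le hle)
      rw [max_eq_left hle, sq_abs, mul_div_cancel₀ _ (pow_ne_zero 2 hf), sub_self]
  refine ⟨RL.ofRingHom δ k, ?_⟩
  rw [← sub_eq_zero, ← map_pow, ← map_mul, ← map_sub, ← coz_eq_bot_iff, ← le_bot_iff,
    ← coz_eq_bot_iff.2 h]
  exact coz_ofRingHom_mono δ hzero

end Truncations

theorem exists_zero_product_of_not_isVonNeumannRegular {α : RL L}
    (hα : ¬ IsVonNeumannRegular α) :
    ∃ β γ : RL L, β * γ = 0 ∧ α * β ≠ 0 ∧ α * γ ≠ 0 := by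
  obtain ⟨δ, f, -, rfl, -⟩ := RL.exists_ofRingHom α α
  have hf : RL.ofRingHom δ f ≠ 0 := fun h => hα (by simp [h, IsVonNeumannRegular])
  obtain ⟨r, hr, hpos⟩ : ∃ r : ℝ, 0 < r ∧
      RL.ofRingHom δ (f * (|f| - ContinuousMap.const _ r)⁺) ≠ 0 := by
    contrapose! hf
    exact ofRingHom_eq_zero_of_forall_mul_posPart hf
  have hneg := mt (isVonNeumannRegular_ofRingHom_of_mul_negPart hr) hα
  rw [map_mul] at hpos hneg
  refine ⟨_, _, ?_, hpos, hneg⟩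
  rw [← map_mul, ← map_zero (RL.ofRingHom δ)]
  congr 1
  ext z
  change (|f z| - r)⁺ * (|f z| - r)⁻ = 0
  rcases le_total (|f z| - r) 0 with hle | hge
  · rw [posPart_eq_zero.2 hle, zero_mul]
  · rw [negPart_eq_zero.2 hge, mul_zero]

end ZeroProducts

section ZrIdeals

variable {L : Type*} [Order.Frame L] {I : Ideal (RL L)}

theorem IsZIdeal.mem_of_pow_mem {α : RL L} {n : ℕ} (hI : IsZIdeal I) (hn : n ≠ 0)
    (h : α ^ n ∈ I) : α ∈ I :=
  hI _ _ h (coz_pow α hn).symm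

theorem IsZIdeal.sup_vonNeumannRegularIdeal (hI : IsZIdeal I) :
    IsZIdeal (I ⊔ vonNeumannRegularIdeal (RL L)) := by
  intro α φ hφ hcoz
  obtain ⟨e, he, hφe⟩ := mem_sup_vonNeumannRegularIdeal.1 hφ
  refine mem_sup_vonNeumannRegularIdeal.2 ⟨e, he, hI _ _ hφe ?_⟩
  rw [coz_mul, coz_mul, hcoz]

theorem IsRIdeal.sup_vonNeumannRegularIdeal (hI : IsRIdeal I) :
    IsRIdeal (I ⊔ vonNeumannRegularIdeal (RL L)) := by
  intro α φ hφ hαφ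
  obtain ⟨e, he, hαφe⟩ := mem_sup_vonNeumannRegularIdeal.1 hαφ
  refine mem_sup_vonNeumannRegularIdeal.2 ⟨e, he, hI _ φ hφ ?_⟩
  rwa [mul_right_comm]

theorem IsZIdeal.of_sup_vonNeumannRegularIdeal
    (hI : IsZIdeal (I ⊔ vonNeumannRegularIdeal (RL L))) : IsZIdeal I := by
  intro α φ hφ hcoz
  obtain ⟨e, he, hαe⟩ := mem_sup_vonNeumannRegularIdeal.1
    (hI α φ (Ideal.mem_sup_left hφ) hcoz)
  obtain ⟨k, hk⟩ := mem_vonNeumannRegularIdeal.1 he (e * φ) (Dvd.intro _ rfl)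
  have hφe : (e * φ) * (1 - e * φ * k) = 0 := by linear_combination hk
  have hcoz' : coz (e * α) ≤ coz (e * φ) := by rw [coz_mul, coz_mul, hcoz]
  have hα : α = α * (1 - e) + e ^ 2 * α * k * φ := by
    linear_combination mul_eq_zero_of_coz_le hcoz' hφe
  rw [hα]
  exact I.add_mem hαe (I.mul_mem_left _ hφ)

theorem IsRIdeal.of_sup_vonNeumannRegularIdeal
    (hI : IsRIdeal (I ⊔ vonNeumannRegularIdeal (RL L))) : IsRIdeal I := by
  intro α φ hφ hαφ
  obtain ⟨e, he, hαe⟩ := mem_sup_vonNeumannRegularIdeal.1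
    (hI α φ hφ (Ideal.mem_sup_left hαφ))
  obtain ⟨k, hk⟩ := mem_vonNeumannRegularIdeal.1 he (e * φ) (Dvd.intro _ rfl)
  have he_eq : e = e ^ 2 * φ * k := hφ.right (by linear_combination hk)
  have hα : α = α * (1 - e) + e ^ 2 * k * (α * φ) := by linear_combination α * he_eq
  rw [hα]
  exact I.add_mem hαe (I.mul_mem_left _ hαφ)

theorem isZrIdeal_sup_vonNeumannRegularIdeal_iff :
    IsZrIdeal (I ⊔ vonNeumannRegularIdeal (RL L)) ↔ IsZrIdeal I :=
  ⟨fun h => ⟨h.1.of_sup_vonNeumannRegularIdeal, h.2.of_sup_vonNeumannRegularIdeal⟩,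
    fun h => ⟨h.1.sup_vonNeumannRegularIdeal, h.2.sup_vonNeumannRegularIdeal⟩⟩

theorem isZrIdeal_annihilator (N : Ideal (RL L)) : IsZrIdeal N.annihilator := by
  refine ⟨fun α φ hφ hcoz => ?_, fun α φ hφ hαφ => ?_⟩ <;>
    rw [Submodule.mem_annihilator] at * <;> intro ν hν
  · exact mul_eq_zero_of_coz_le hcoz.le (hφ ν hν)
  · refine hφ.right ?_
    change α * ν * φ = 0 * φ
    rw [zero_mul, mul_right_comm]
    exact hαφ ν hν

end ZrIdeals

section PFFrames

variable {L : Type*} [Order.Frame L] {I J K : Ideal (RL L)}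

theorem isPFFrame_iff_forall_mul_eq_zero : IsPFFrame L ↔
    ∀ α β : RL L, α * β = 0 → IsVonNeumannRegular α ∨ IsVonNeumannRegular β := by
  simp only [IsPFFrame, CozPart, Set.forall_mem_range, isComplemented_coz_iff,
    coz_inf_coz_eq_bot_iff]

theorem IsPFFrame.mem_vonNeumannRegularIdeal_or (hL : IsPFFrame L) {α β : RL L}
    (h : α * β = 0) : α ∈ vonNeumannRegularIdeal (RL L) ∨ β ∈ vonNeumannRegularIdeal (RL L) := by
  simp only [mem_vonNeumannRegularIdeal]
  by_contra! hc
  obtain ⟨⟨x, ⟨r, rfl⟩, hx⟩, ⟨y, ⟨s, rfl⟩, hy⟩⟩ := hc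
  have hxy : α * r * (β * s) = 0 := by linear_combination r * s * h
  exact (isPFFrame_iff_forall_mul_eq_zero.1 hL _ _ hxy).elim hx hy

theorem IsPFFrame.sq_mem_span_sup_or (hL : IsPFFrame L) (α β : RL L) :
    α ^ 2 ∈ Ideal.span {β} ⊔ vonNeumannRegularIdeal (RL L) ∨
      β ^ 2 ∈ Ideal.span {α} ⊔ vonNeumannRegularIdeal (RL L) := by
  have mem_of_sub_mem {x y k : RL L} (h : x - y * k ∈ vonNeumannRegularIdeal (RL L)) :
      x ∈ Ideal.span {y} ⊔ vonNeumannRegularIdeal (RL L) := by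
    rw [← add_sub_cancel (y * k) x]
    exact Submodule.add_mem_sup (Ideal.mul_mem_right _ _ (Ideal.mem_span_singleton_self y)) h
  obtain ⟨κ, μ, h⟩ := exists_sq_sub_mul_mul_sq_sub_mul_eq_zero α β
  exact (hL.mem_vonNeumannRegularIdeal_or h).imp mem_of_sub_mem mem_of_sub_mem

theorem IsPFFrame.isPrime_of_isZIdeal (hL : IsPFFrame L) (hK : IsZIdeal K)
    (hMK : vonNeumannRegularIdeal (RL L) ≤ K) (htop : K ≠ ⊤) : K.IsPrime := by
  have mem_of_sq_mem {x y : RL L} (hxy : x * y ∈ K)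
      (h : x ^ 2 ∈ Ideal.span {y} ⊔ vonNeumannRegularIdeal (RL L)) : x ∈ K := by
    obtain ⟨_, hs, m, hm, hsum⟩ := Submodule.mem_sup.1 h
    obtain ⟨k, rfl⟩ := Ideal.mem_span_singleton.1 hs
    refine hK.mem_of_pow_mem three_ne_zero ?_
    have hx : x ^ 3 = k * (x * y) + x * m := by linear_combination -x * hsum
    rw [hx]
    exact K.add_mem (K.mul_mem_left _ hxy) (K.mul_mem_left _ (hMK hm))
  refine ⟨htop, fun {α β} h => ?_⟩
  exact (hL.sq_mem_span_sup_or α β).imp (mem_of_sq_mem h) (mem_of_sq_mem (mul_comm α β ▸ h))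

theorem IsPFFrame.le_or_le_of_inf_le (hL : IsPFFrame L) (hK : IsZIdeal K)
    (hMK : vonNeumannRegularIdeal (RL L) ≤ K) (h : I ⊓ J ≤ K) : I ≤ K ∨ J ≤ K := by
  by_cases htop : K = ⊤
  · exact Or.inl (htop ▸ le_top)
  · exact (hL.isPrime_of_isZIdeal hK hMK htop).inf_le.1 h

theorem IsPFFrame.isZrIdeal_or_of_inf (hL : IsPFFrame L) (h : IsZrIdeal (I ⊓ J)) :
    IsZrIdeal I ∨ IsZrIdeal J := by
  have hK := isZrIdeal_sup_vonNeumannRegularIdeal_iff.2 h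
  have isZrIdeal_of_le {I' : Ideal (RL L)} (hle : I ⊓ J ≤ I')
      (hI' : I' ≤ I ⊓ J ⊔ vonNeumannRegularIdeal (RL L)) : IsZrIdeal I' := by
    rwa [← isZrIdeal_sup_vonNeumannRegularIdeal_iff,
      le_antisymm (sup_le hI' le_sup_right) (sup_le_sup_right hle _)]
  exact (hL.le_or_le_of_inf_le hK.1 le_sup_right le_sup_left).imp
    (isZrIdeal_of_le inf_le_left) (isZrIdeal_of_le inf_le_right)

theorem IsPFFrame.isZrIdeal_add (hL : IsPFFrame L) (hI : IsZrIdeal I) (hJ : IsZrIdeal J) :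
    IsZrIdeal (I + J) := by
  have hI' := isZrIdeal_sup_vonNeumannRegularIdeal_iff.2 hI
  have hJ' := isZrIdeal_sup_vonNeumannRegularIdeal_iff.2 hJ
  have hK : IsZIdeal ((I ⊔ vonNeumannRegularIdeal (RL L)) ⊓ (J ⊔ vonNeumannRegularIdeal (RL L))) :=
    fun α φ hφ hcoz => ⟨hI'.1 α φ hφ.1 hcoz, hJ'.1 α φ hφ.2 hcoz⟩
  rw [← isZrIdeal_sup_vonNeumannRegularIdeal_iff, Submodule.add_eq_sup, sup_sup_distrib_right]
  rcases hL.le_or_le_of_inf_le hK (le_inf le_sup_right le_sup_right) le_rfl with h | h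
  · rwa [sup_eq_right.2 (le_inf_iff.1 h).2]
  · rwa [sup_eq_left.2 (le_inf_iff.1 h).1]

theorem IsPFFrame.isZrIdeal_or_of_add (hL : IsPFFrame L) (h : IsZrIdeal (I + J)) :
    IsZrIdeal I ∨ IsZrIdeal J := by
  have hK := isZrIdeal_sup_vonNeumannRegularIdeal_iff.2 h
  rw [Submodule.add_eq_sup, sup_sup_distrib_right] at hK
  simp only [← isZrIdeal_sup_vonNeumannRegularIdeal_iff (I := I),
    ← isZrIdeal_sup_vonNeumannRegularIdeal_iff (I := J)]
  set I' := I ⊔ vonNeumannRegularIdeal (RL L)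
  set J' := J ⊔ vonNeumannRegularIdeal (RL L)
  have hsubset : (↑(I' ⊔ J') : Set (RL L)) ⊆ I' ∪ J' := by
    intro φ hφ
    obtain ⟨ρ, rfl⟩ := exists_pow_eq_of_odd (n := 3) (by decide) φ
    obtain ⟨α, hα, β, hβ, rfl⟩ := Submodule.mem_sup.1 (hK.1.mem_of_pow_mem three_ne_zero hφ)
    rcases hL.sq_mem_span_sup_or α β with hαβ | hβα
    · right
      have hα' := sup_le ((Ideal.span_singleton_le_iff_mem J').2 hβ) le_sup_right hαβ
      have hexpand : (α + β) ^ 3 = α ^ 2 * (α + 3 * β) + β * (3 * α * β + β ^ 2) := by ring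
      rw [hexpand]
      exact J'.add_mem (J'.mul_mem_right _ hα') (J'.mul_mem_right _ hβ)
    · left
      have hβ' := sup_le ((Ideal.span_singleton_le_iff_mem I').2 hα) le_sup_right hβα
      have hexpand : (α + β) ^ 3 = α * (α ^ 2 + 3 * α * β) + β ^ 2 * (3 * α + β) := by ring
      rw [hexpand]
      exact I'.add_mem (I'.mul_mem_right _ hα) (I'.mul_mem_right _ hβ')
  rcases Ideal.subset_union.1 hsubset with hle | hle
  · exact Or.inl (le_antisymm hle le_sup_left ▸ hK)
  · exact Or.inr (le_antisymm hle le_sup_right ▸ hK)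

end PFFrames

section Converse

variable {L : Type*} [Order.Frame L] {K : Ideal (RL L)} {α : RL L}

theorem IsZIdeal.isVonNeumannRegular_of_span_sup (h : IsZIdeal (Ideal.span {α} ⊔ K))
    (hK : K ≤ (Ideal.span {α}).annihilator) : IsVonNeumannRegular α := by
  obtain ⟨ρ, rfl⟩ := exists_pow_eq_of_odd (n := 3) (by decide) α
  have hρ : ρ ∈ Ideal.span {ρ ^ 3} ⊔ K :=
    h.mem_of_pow_mem three_ne_zero (Ideal.mem_sup_left (Ideal.mem_span_singleton_self _))
  obtain ⟨_, hs, ν, hν, hsum⟩ := Submodule.mem_sup.1 hρ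
  obtain ⟨k, rfl⟩ := Ideal.mem_span_singleton.1 hs
  have hρν : ρ * ν = 0 := by
    refine mul_eq_zero_of_coz_le (coz_pow ρ three_ne_zero).ge ?_
    rw [mul_comm]
    exact Submodule.mem_annihilator_span_singleton _ _ |>.1 (hK hν)
  have hρsq : ρ ^ 2 = ρ ^ 4 * k := by linear_combination -ρ * hsum + hρν
  exact ⟨ρ * k ^ 2, by linear_combination (ρ + ρ ^ 3 * k) * hρsq⟩

theorem exists_multiple_not_isVonNeumannRegular (hα : ¬ IsVonNeumannRegular α) :
    ∃ α' δ : RL L, α ∣ α' ∧ α ∣ δ ∧ ¬ IsVonNeumannRegular α' ∧ δ ≠ 0 ∧ α' * δ = 0 := by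
  obtain ⟨β, γ, hβγ, hβ, hγ⟩ := exists_zero_product_of_not_isVonNeumannRegular hα
  by_cases hreg : IsVonNeumannRegular (α * γ)
  · obtain ⟨k, hk⟩ := hreg
    refine ⟨α - α ^ 2 * (γ * k), α * γ, ⟨1 - α * (γ * k), by ring⟩, Dvd.intro _ rfl,
      mt IsVonNeumannRegular.of_sub_sq_mul hα, hγ, ?_⟩
    linear_combination α * hk
  · exact ⟨α * γ, α * β, Dvd.intro _ rfl, Dvd.intro _ rfl, hreg, hβ,
      by linear_combination α ^ 2 * hβγ⟩

theorem isPFFrame_of_inf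
    (h : ∀ I J : Ideal (RL L), IsZrIdeal (I ⊓ J) → IsZrIdeal I ∨ IsZrIdeal J) :
    IsPFFrame L := by
  refine isPFFrame_iff_forall_mul_eq_zero.2 fun α β hαβ => ?_
  have hbot : Ideal.span {α} ⊓ Ideal.span {β} = ⊥ := by
    refine eq_bot_iff.2 fun x ⟨hxα, hxβ⟩ => ?_
    obtain ⟨k, rfl⟩ := Ideal.mem_span_singleton.1 hxα
    obtain ⟨l, hl⟩ := Ideal.mem_span_singleton.1 hxβ
    have hsq : (α * k) ^ 2 = 0 := by linear_combination (α * k) * hl + k * l * hαβ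
    exact pow_eq_zero_iff two_ne_zero |>.1 hsq
  have isVonNeumannRegular_of_span {γ : RL L} (hγ : IsZrIdeal (Ideal.span {γ})) :
      IsVonNeumannRegular γ :=
    IsZIdeal.isVonNeumannRegular_of_span_sup (K := ⊥) (by rw [sup_bot_eq]; exact hγ.1) bot_le
  have hzr : IsZrIdeal (⊥ : Ideal (RL L)) := by
    have htop := isZrIdeal_annihilator (⊤ : Ideal (RL L))
    rwa [Submodule.annihilator_top, Module.annihilator_eq_bot.2 inferInstance] at htop
  exact (h _ _ (hbot ▸ hzr)).imp isVonNeumannRegular_of_span isVonNeumannRegular_of_span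

theorem isPFFrame_of_add
    (hadd : ∀ I J : Ideal (RL L), IsZrIdeal I → IsZrIdeal J → IsZrIdeal (I + J) ∨ I + J = ⊤)
    (hsplit : ∀ I J : Ideal (RL L), I + J ≠ ⊤ → IsZrIdeal (I + J) → IsZrIdeal I ∨ IsZrIdeal J) :
    IsPFFrame L := by
  refine isPFFrame_iff_forall_mul_eq_zero.2 fun α β hαβ => ?_
  by_contra! hc
  obtain ⟨α', δ, hα', hδ, hreg, hδ0, hα'δ⟩ := exists_multiple_not_isVonNeumannRegular hc.1
  have hα'β : α' * β = 0 := zero_dvd_iff.1 (hαβ ▸ mul_dvd_mul_right hα' β)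
  have hδβ : δ * β = 0 := zero_dvd_iff.1 (hαβ ▸ mul_dvd_mul_right hδ β)
  have mem_annihilator_pair {x y z : RL L} :
      x ∈ (Ideal.span {y, z}).annihilator ↔ x * y = 0 ∧ x * z = 0 := by
    simp [Submodule.mem_annihilator_span]
  let P := (Ideal.span {α', δ}).annihilator
  let Q := (Ideal.span {β, δ}).annihilator
  have htop : P + Q ≠ ⊤ := by
    intro h
    obtain ⟨p, hp, q, hq, hpq⟩ := Submodule.mem_sup.1 (h ▸ Submodule.mem_top : (1 : RL L) ∈ P + Q)
    refine hδ0 ?_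
    linear_combination -δ * hpq + (mem_annihilator_pair.1 hp).2 + (mem_annihilator_pair.1 hq).2
  have hzr : IsZrIdeal (P + Q) :=
    (hadd P Q (isZrIdeal_annihilator _) (isZrIdeal_annihilator _)).resolve_right htop
  have hα'Q : Ideal.span {α'} ≤ Q :=
    (Ideal.span_singleton_le_iff_mem Q).2 (mem_annihilator_pair.2 ⟨hα'β, hα'δ⟩)
  have hβP : Ideal.span {β} ≤ P := (Ideal.span_singleton_le_iff_mem P).2
    (mem_annihilator_pair.2 ⟨mul_comm α' β ▸ hα'β, mul_comm δ β ▸ hδβ⟩)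
  have hsum : (Ideal.span {α'} ⊔ P) + (Ideal.span {β} ⊔ Q) = P + Q := by
    rw [Submodule.add_eq_sup, sup_sup_sup_comm, ← Submodule.add_eq_sup P Q]
    refine sup_eq_right.2 (sup_le ?_ ?_)
    exacts [hα'Q.trans le_sup_right, hβP.trans le_sup_left]
  rcases hsplit _ _ (hsum ▸ htop) (hsum ▸ hzr) with h | h
  · exact hreg (h.1.isVonNeumannRegular_of_span_sup
      (Submodule.annihilator_mono (Ideal.span_mono (by simp))))
  · exact hc.2 (h.1.isVonNeumannRegular_of_span_sup
      (Submodule.annihilator_mono (Ideal.span_mono (by simp))))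

end Converse

end PFFrame

theorem mainTheorem5_general {L : Type*} [Order.Frame L] :
    List.TFAE [
      (∀ I J : Ideal (PFFrame.RL L), PFFrame.IsZrIdeal I → PFFrame.IsZrIdeal J →
          PFFrame.IsZrIdeal (I + J) ∨ I + J = ⊤) ∧
        (∀ I J : Ideal (PFFrame.RL L), I + J ≠ ⊤ → PFFrame.IsZrIdeal (I + J) →
          PFFrame.IsZrIdeal I ∨ PFFrame.IsZrIdeal J),
      PFFrame.IsPFFrame L,
      ∀ I J : Ideal (PFFrame.RL L), PFFrame.IsZrIdeal (I ⊓ J) →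
        PFFrame.IsZrIdeal I ∨ PFFrame.IsZrIdeal J] := by
  tfae_have 1 → 2 := fun h => PFFrame.isPFFrame_of_add h.1 h.2
  tfae_have 2 → 1 := fun h =>
    ⟨fun _ _ hI hJ => Or.inl (h.isZrIdeal_add hI hJ), fun _ _ _ hIJ => h.isZrIdeal_or_of_add hIJ⟩
  tfae_have 3 → 2 := PFFrame.isPFFrame_of_inf
  tfae_have 2 → 3 := fun h _ _ hIJ => h.isZrIdeal_or_of_inf hIJ
  tfae_finish

theorem mainTheorem5 {L : Type*} [Order.Frame L] (hL : PFFrame.IsCompletelyRegular L) :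
    List.TFAE [
      (∀ I J : Ideal (PFFrame.RL L), PFFrame.IsZrIdeal I → PFFrame.IsZrIdeal J →
          PFFrame.IsZrIdeal (I + J) ∨ I + J = ⊤) ∧
        (∀ I J : Ideal (PFFrame.RL L), I + J ≠ ⊤ → PFFrame.IsZrIdeal (I + J) →
          PFFrame.IsZrIdeal I ∨ PFFrame.IsZrIdeal J),
      PFFrame.IsPFFrame L,
      ∀ I J : Ideal (PFFrame.RL L), PFFrame.IsZrIdeal (I ⊓ J) →
        PFFrame.IsZrIdeal I ∨ PFFrame.IsZrIdeal J] :=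
  mainTheorem5_general
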